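/- **Theorem 1 (Optimality of the JIT policy).** *Plant and filter.* Let $x_{n+1}=Ax_n+Bu_n+w_n$, $y_{n+1}=Hx_{n+1}+v_{n+1}$ with $x_n\in\mathbb R^d$, $u_n\in\mathbb R^m$, $y_n\in\mathbb R^p$, where $x_0\sim\mathcal N(\hat x_{0|0},P_{0|0})$ with $P_{0|0}\succeq 0$ given, $w_n\sim\mathcal N(0,Q)$ are i.i.d. with $Q\succ0$, the measurement noise covariances $R_n$ $(n\ge1)$ are i.i.d. and almost surely positive definite, and the $v_n$ are independent with $v_n\sim\mathcal N(0,R_n)$ given $R_n$; $x_0$, $(w_n)$ and $(R_n,v_n)$ are independent. The sensor runs the Kalman filter, with covariances $$P_{n+1|n}=AP_{n|n}A^\top+Q,\qquad P_{n+1|n+1}=P_{n+1|n}-P_{n+1|n}H^\top(HP_{n+1|n}H^\top+R_{n+1})^{-1}HP_{n+1|n},$$ and $P_{j+k|j}$ denotes the $k$-fold image of $P_{j|j}$ under $P\mapsto APA^\top+Q$. In each slot $n$ the sensor chooses $a_n\in\{0,1\}$. The controller's estimate and covariance start at $\hat x_{0|0}$ and $P^{\mathrm c}_0=P_{0|0}$;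 for $n\ge1$, if $a_n=1$ the sensor's estimate is copied to the controller and $P^{\mathrm c}_n=P_{n|n}$, and if $a_n=0$ the controller predicts in open loop and $P^{\mathrm c}_n=AP^{\mathrm c}_{n-1}A^\top+Q$. The control is $u_n=\mu(\hat x^{\mathrm c}_n,P^{\mathrm c}_n)$ for a fixed measurable map $\mu$. *Tolerances.* Let $(\tau_n)_{n\ge0}$ be positive, stationary and ergodic, independent of $(R_n)$. A policy is *causal* if $a_n$ is a measurable function of the whole sequence $(\tau_k)_{k\ge0}$, of $R_1,\dots,R_n$ and of $y_1,\dots,y_n$. With $\beta>0$, $c\ge0$, its long-run reward is $$J(\pi)=\liminf_{N\to\infty}\frac1N\,\mathbb E\Big[\sum_{n=0}^{N-1}\big(\mathbf 1\{\operatorname{tr}P^{\mathrm c}_n\le\tau_n\}-\beta c\,a_n\big)\Big].$$ *JIT policy.* Let $T_j=\min\{k\ge1:\operatorname{tr}P_{j+k|j}>\tau_{j+k}\}$ (with $\min\varnothing=\infty$). For $n\ge1$ let $m<n$ be the last slot before $n$ with a transmission ($m=0$ if there is none), and let $\Delta_n=T_m-(n-1-m)$ be the residual validity left at the end of slot $n-1$,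 so that $\Delta_n=1$ means that without a transmission the cap is violated in slot $n$. The just-in-time policy $\pi^{\mathrm{JIT}}$ has $a_0=0$ and, for $n\ge1$, $a_n=1$ exactly when $\Delta_n=1$. Let $m_1<m_2<\cdots$ be its transmission slots (with $T_{m_k}:=\infty$ if there are fewer than $k$ of them). *Claim.* Assume that $\operatorname{tr}P_{n|n}\le\tau_n$ almost surely for every $n$, that the limit $$\bar T=\lim_{K\to\infty}\frac1K\sum_{k=1}^K T_{m_k}\in(0,\infty]$$ exists almost surely and is a constant, and that $\beta c\le1$ and $\beta c<\bar T$. Then $\pi^{\mathrm{JIT}}$ is causal, $J(\pi)\le J(\pi^{\mathrm{JIT}})$ for every causal policy $\pi$, and $$J(\pi^{\mathrm{JIT}})=1-\frac{\beta c}{\bar T}$$ (with $\beta c/\infty=0$). -/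

import Mathlib

open MeasureTheory ProbabilityTheory Filter Topology
open scoped Matrix ENNReal

noncomputable section

namespace JIT

/-- Real matrices carry the product (equivalently, Borel) sigma-algebra. -/
instance instMeasurableSpaceMatrix (m n : ℕ) : MeasurableSpace (Matrix (Fin m) (Fin n) ℝ) :=
  inferInstanceAs (MeasurableSpace (Fin m → Fin n → ℝ))

/-- The deterministic data of the linear plant
`x (n+1) = A x n + B u n + w n`, `y (n+1) = H x (n+1) + v (n+1)`, with process noise covariance
`Q`, initial estimate `xhat0`, initial error covariance `P0`, and the fixed control law
`u n = controller (controller's estimate, controller's covariance)`. -/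
structure Plant (d m p : ℕ) where
  A : Matrix (Fin d) (Fin d) ℝ
  B : Matrix (Fin d) (Fin m) ℝ
  H : Matrix (Fin p) (Fin d) ℝ
  Q : Matrix (Fin d) (Fin d) ℝ
  xhat0 : Fin d → ℝ
  P0 : Matrix (Fin d) (Fin d) ℝ
  controller : (Fin d → ℝ) → Matrix (Fin d) (Fin d) ℝ → (Fin m → ℝ)

section Pathwise

variable {d m p : ℕ} (S : Plant d m p)

/-- Open-loop prediction of the error covariance: `P ↦ A P Aᵀ + Q`. -/
def Plant.predCov (P : Matrix (Fin d) (Fin d) ℝ) : Matrix (Fin d) (Fin d) ℝ :=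
  S.A * P * S.Aᵀ + S.Q

/-- Kalman gain for predicted covariance `M` and measurement noise covariance `Rn`. -/
def Plant.gain (M : Matrix (Fin d) (Fin d) ℝ) (Rn : Matrix (Fin p) (Fin p) ℝ) :
    Matrix (Fin d) (Fin p) ℝ :=
  M * S.Hᵀ * (S.H * M * S.Hᵀ + Rn)⁻¹

/-- Kalman measurement update of the error covariance. -/
def Plant.updCov (M : Matrix (Fin d) (Fin d) ℝ) (Rn : Matrix (Fin p) (Fin p) ℝ) :
    Matrix (Fin d) (Fin d) ℝ :=
  M - S.gain M Rn * S.H * M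

variable (R : ℕ → Matrix (Fin p) (Fin p) ℝ) (τ : ℕ → ℝ)

/-- The sensor's Kalman filter covariance `P_{n|n}`. -/
def Plant.postCov : ℕ → Matrix (Fin d) (Fin d) ℝ
  | 0 => S.P0
  | n + 1 => S.updCov (S.predCov (Plant.postCov n)) (R (n + 1))

/-- The `k`-step open-loop prediction covariance `P_{j+k|j}`. -/
def Plant.aheadCov (j k : ℕ) : Matrix (Fin d) (Fin d) ℝ :=
  S.predCov^[k] (S.postCov R j)

/-- The controller's error covariance at slot `n` when the transmission decisions are `a`. At
slot `0` the controller holds the sensor's initial estimate. -/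
def Plant.ctrlCov (a : ℕ → Bool) : ℕ → Matrix (Fin d) (Fin d) ℝ
  | 0 => S.P0
  | n + 1 => if a (n + 1) then S.postCov R (n + 1) else S.predCov (Plant.ctrlCov a n)

/-- The closed-loop triple (plant state `x n`, sensor's estimate at `n` given the measurements up
to `n`, controller's estimate at `n`), for initial state `x0`, process noise `w`, measurement
noise `v` and transmission decisions `a`. -/
def Plant.loop (x0 : Fin d → ℝ) (w : ℕ → Fin d → ℝ) (v : ℕ → Fin p → ℝ) (a : ℕ → Bool) :
    ℕ → (Fin d → ℝ) × (Fin d → ℝ) × (Fin d → ℝ)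
  | 0 => (x0, S.xhat0, S.xhat0)
  | n + 1 =>
    let s := Plant.loop x0 w v a n
    let u : Fin m → ℝ := S.controller s.2.2 (S.ctrlCov R a n)
    let x : Fin d → ℝ := S.A *ᵥ s.1 + S.B *ᵥ u + w n
    let y : Fin p → ℝ := S.H *ᵥ x + v (n + 1)
    let xpred : Fin d → ℝ := S.A *ᵥ s.2.1 + S.B *ᵥ u
    let xhat : Fin d → ℝ :=
      xpred + S.gain (S.predCov (S.postCov R n)) (R (n + 1)) *ᵥ (y - S.H *ᵥ xpred)
    (x, xhat, if a (n + 1) then xhat else S.A *ᵥ s.2.2 + S.B *ᵥ u)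

/-- The measurement `y n = H x n + v n` (used for `n ≥ 1`). -/
def Plant.meas (x0 : Fin d → ℝ) (w : ℕ → Fin d → ℝ) (v : ℕ → Fin p → ℝ) (a : ℕ → Bool)
    (n : ℕ) : Fin p → ℝ :=
  S.H *ᵥ (S.loop R x0 w v a n).1 + v n

/-- MSE-based expiration time of the estimate transmitted at slot `j`: the least `k ≥ 1` with
`tr P_{j+k|j} > τ (j+k)`, and `⊤` if there is none. -/
def Plant.expiration (j : ℕ) : ℕ∞ :=
  ⨅ (k : ℕ) (_ : 1 ≤ k ∧ τ (j + k) < (S.aheadCov R j k).trace), (k : ℕ∞)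

/-- The most recent transmission epoch strictly before slot `n`; the initial estimate, shared by
sensor and controller, counts as an epoch at slot `0`. -/
def lastTx (a : ℕ → Bool) : ℕ → ℕ
  | 0 => 0
  | n + 1 => if a n then n else lastTx a n

/-- Slots of validity that an estimate transmitted at `j` has left when the decision of slot `n`
is due (`j < n`), that is after the `n - 1 - j` full slots that followed its transmission slot:
it is `k` exactly when the estimate expires in slot `n - 1 + k`. Values below zero are recorded
as `0`. -/
def Plant.validityFrom (j n : ℕ) : ℕ∞ :=
  S.expiration R τ j - ((n - 1 - j : ℕ) : ℕ∞)

/-- The residual validity of the controller's current estimate, just before the decision of slot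
`n ≥ 1`. -/
def Plant.residualValidity (a : ℕ → Bool) (n : ℕ) : ℕ∞ :=
  S.validityFrom R τ (lastTx a n) n

/-- The most recent epoch before slot `n` under the just-in-time rule. -/
def Plant.jitLast : ℕ → ℕ
  | 0 => 0
  | n + 1 =>
    if 1 ≤ n ∧ S.validityFrom R τ (Plant.jitLast n) n = 1 then n else Plant.jitLast n

open Classical in
/-- The just-in-time policy; see `jit_iff` for its defining property. -/
def Plant.jit (n : ℕ) : Bool :=
  decide (1 ≤ n ∧ S.validityFrom R τ (S.jitLast R τ n) n = 1)

theorem lastTx_jit (n : ℕ) : lastTx (S.jit R τ) n = S.jitLast R τ n := by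
  induction n with
  | zero => rfl
  | succ n ih => simp [lastTx, Plant.jitLast, Plant.jit, ih]

/-- The just-in-time policy is silent at slot `0`, and at slots `n ≥ 1` it transmits exactly when
the residual validity (along its own decisions) is one. -/
theorem jit_iff (n : ℕ) :
    S.jit R τ n = true ↔ 1 ≤ n ∧ S.residualValidity R τ (S.jit R τ) n = 1 := by
  rw [Plant.residualValidity, lastTx_jit]
  simp [Plant.jit]

/-- Expiration time of the estimate sent at the `(k+1)`-st just-in-time transmission (the
infimum runs over that slot only); `⊤` if there are at most `k` transmissions, in which case the
last estimate held by the controller never expires. -/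
def Plant.jitExpiration (k : ℕ) : ℕ∞ :=
  ⨅ (n : ℕ) (_ : S.jit R τ n = true ∧ Nat.count (fun i => S.jit R τ i = true) n = k),
    S.expiration R τ n

open Classical in
/-- Reward of slot `n`: one if the cap on the controller's mean-squared error holds, minus the
weighted cost of a transmission. -/
def Plant.reward (β c : ℝ) (a : ℕ → Bool) (n : ℕ) : ℝ :=
  (if (S.ctrlCov R a n).trace ≤ τ n then 1 else 0) - β * c * (if a n then 1 else 0)

end Pathwise

section Stochastic

variable {d m p : ℕ} {Ω : Type*}

/-- The long-run expected reward of the decision process `a`. -/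
def Plant.value [MeasurableSpace Ω] (S : Plant d m p) (μ : Measure Ω)
    (R : ℕ → Ω → Matrix (Fin p) (Fin p) ℝ)
    (τ : ℕ → Ω → ℝ) (β c : ℝ) (a : ℕ → Ω → Bool) : ℝ :=
  liminf (fun N : ℕ => (1 / (N : ℝ)) *
    ∫ ω, ∑ n ∈ Finset.range N,
      S.reward (fun k => R k ω) (fun k => τ k ω) β c (fun k => a k ω) n ∂μ) atTop

/-- What the sensor knows at its decision in slot `n`: the entire tolerance sequence, the noise
covariances `R 1, …, R n` and the measurements `y 1, …, y n`. -/
@[reducible] def Plant.info (S : Plant d m p) (x0 : Ω → Fin d → ℝ) (w : ℕ → Ω → Fin d → ℝ)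
    (v : ℕ → Ω → Fin p → ℝ) (R : ℕ → Ω → Matrix (Fin p) (Fin p) ℝ) (τ : ℕ → Ω → ℝ)
    (a : ℕ → Ω → Bool) (n : ℕ) : MeasurableSpace Ω :=
  MeasurableSpace.comap
    (fun ω => ((fun k : ℕ => τ k ω), (fun k : Fin n => R (k + 1) ω),
      (fun k : Fin n =>
        S.meas (fun i => R i ω) (x0 ω) (fun i => w i ω) (fun i => v i ω) (fun i => a i ω) (k + 1))))
    inferInstance

/-- Causal policies: every decision is a function of what the sensor knows at that slot, in the
closed loop that the policy itself generates. -/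
def Plant.Causal (S : Plant d m p) (x0 : Ω → Fin d → ℝ) (w : ℕ → Ω → Fin d → ℝ)
    (v : ℕ → Ω → Fin p → ℝ) (R : ℕ → Ω → Matrix (Fin p) (Fin p) ℝ) (τ : ℕ → Ω → ℝ)
    (a : ℕ → Ω → Bool) : Prop :=
  ∀ n, Measurable[S.info x0 w v R τ a n] (a n)

/-- The just-in-time policy as a decision process. -/
def Plant.jitPolicy (S : Plant d m p) (R : ℕ → Ω → Matrix (Fin p) (Fin p) ℝ) (τ : ℕ → Ω → ℝ) :
    ℕ → Ω → Bool :=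
  fun n ω => S.jit (fun k => R k ω) (fun k => τ k ω) n

/-- The linear Gaussian model. The initial state is Gaussian with the filter's initial estimate
and covariance; the process noise is i.i.d. `N(0, Q)` with `Q` positive definite; the measurement
noise covariances `R n`, `n ≥ 1`, are i.i.d. and positive definite, and given `R n` the
measurement noise `v n` is `N(0, R n)`, independently over `n`. -/
structure Plant.IsLinearGaussian [MeasurableSpace Ω] (S : Plant d m p) (μ : Measure Ω)
    [IsProbabilityMeasure μ]
    (x0 : Ω → Fin d → ℝ) (w : ℕ → Ω → Fin d → ℝ) (v : ℕ → Ω → Fin p → ℝ)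
    (R : ℕ → Ω → Matrix (Fin p) (Fin p) ℝ) : Prop where
  P0_posSemidef : S.P0.PosSemidef
  Q_posDef : S.Q.PosDef
  measurable_controller : Measurable (Function.uncurry S.controller)
  measurable_x0 : Measurable x0
  measurable_w : ∀ n, Measurable (w n)
  measurable_v : ∀ n, Measurable (v n)
  measurable_R : ∀ n, Measurable (R n)
  law_x0 : HasLaw (fun ω => WithLp.toLp 2 (x0 ω))
    (multivariateGaussian (WithLp.toLp 2 S.xhat0) S.P0) μ
  law_w : ∀ n, HasLaw (fun ω => WithLp.toLp 2 (w n ω)) (multivariateGaussian 0 S.Q) μ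
  indep_w : iIndepFun w μ
  R_posDef : ∀ n, ∀ᵐ ω ∂μ, (R (n + 1) ω).PosDef
  identDistrib_R : ∀ n, IdentDistrib (R (n + 1)) (R 1) μ μ
  law_v : ∀ n, ∀ᵐ r ∂(μ.map (R (n + 1))),
    condDistrib (fun ω => WithLp.toLp 2 (v (n + 1) ω)) (R (n + 1)) μ r = multivariateGaussian 0 r
  indep_R_v : iIndepFun (fun n ω => (R (n + 1) ω, v (n + 1) ω)) μ
  indep_w_R_v : IndepFun (fun ω n => w n ω) (fun ω n => (R (n + 1) ω, v (n + 1) ω)) μ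
  indep_x0 : IndepFun x0 (fun ω => ((fun n => w n ω), fun n => (R (n + 1) ω, v (n + 1) ω))) μ

/-- The tolerances are positive, and form a stationary ergodic process independent of the
measurement noise covariances. -/
structure IsToleranceProcess [MeasurableSpace Ω] (μ : Measure Ω)
    (R : ℕ → Ω → Matrix (Fin p) (Fin p) ℝ) (τ : ℕ → Ω → ℝ) : Prop where
  measurable : ∀ n, Measurable (τ n)
  pos : ∀ n, ∀ᵐ ω ∂μ, 0 < τ n ω
  stationary_ergodic : Ergodic (fun (s : ℕ → ℝ) n => s (n + 1)) (μ.map (fun ω n => τ n ω))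
  indep : IndepFun (fun ω n => τ n ω) (fun ω n => R (n + 1) ω) μ

end Stochastic

end JIT

end

/-!
The proof is pathwise; probability enters only at the end, through dominated convergence.

Along a path on which all noise covariances are positive definite, the Kalman update decreases
covariances in the Loewner order and open-loop prediction is monotone for it. So the controller's
covariance always dominates the sensor's, and, if nothing is sent in the slots `j + 1, …, n`, it
dominates the prediction `P_{n|j}` at slot `n` (`Plant.ctrlCov_sub_aheadCov_posSemidef`). If `j < n`
are consecutive just-in-time transmission slots (the first one being preceded by `j = 0`), then
`tr P_{n|j} > τ n` by definition of the expiration time. Hence every decision sequence either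
transmits or violates the cap somewhere in `(j, n]` (`Plant.exists_costly`). Such a costly slot
loses at least `β c`, because `β c ≤ 1`, while the just-in-time policy never violates the cap
(`Plant.trace_ctrlCov_jit_le`) and pays `β c` exactly once per such interval. The just-in-time policy
therefore maximizes the reward sum for every horizon (`Plant.sum_reward_le_sum_reward_jit`).

For the value, each just-in-time transmission takes place exactly when its predecessor expires, so
the transmission slots are the partial sums of the expiration times, shifted by the expiration time
of the initial estimate (`Plant.slot_eq_sum_jitExpiration`). An elementary renewal argument turns
the mean expiration time `Tbar` into the transmission rate `1 / Tbar`
(`Plant.tendsto_count_jit_div`).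

Causality of the just-in-time policy and the measurability of an arbitrary causal policy, whose
measurements depend on its own earlier decisions, are proved by induction over the slots.
-/

namespace JIT

section Pathwise

variable {d m p : ℕ} (S : Plant d m p)
variable (R : ℕ → Matrix (Fin p) (Fin p) ℝ) (τ : ℕ → ℝ)

/-! ### Loewner-order comparison of the covariances -/

theorem Plant.predCov_posSemidef (hQ : S.Q.PosSemidef) {P : Matrix (Fin d) (Fin d) ℝ}
    (hP : P.PosSemidef) : (S.predCov P).PosSemidef := by
  have := hP.mul_mul_conjTranspose_same S.A
  rw [Matrix.conjTranspose_eq_transpose_of_trivial] at this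
  exact this.add hQ

theorem Plant.predCov_sub_posSemidef {P P' : Matrix (Fin d) (Fin d) ℝ}
    (h : (P' - P).PosSemidef) : (S.predCov P' - S.predCov P).PosSemidef := by
  have := h.mul_mul_conjTranspose_same S.A
  rw [Matrix.conjTranspose_eq_transpose_of_trivial] at this
  convert this using 1
  simp only [Plant.predCov]
  noncomm_ring

/-- The innovation covariance `H M Hᵀ + R` is positive definite. -/
theorem Plant.innovCov_posDef {M : Matrix (Fin d) (Fin d) ℝ} (hM : M.PosSemidef)
    {Rn : Matrix (Fin p) (Fin p) ℝ} (hR : Rn.PosDef) : (S.H * M * S.Hᵀ + Rn).PosDef := by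
  have := hM.mul_mul_conjTranspose_same S.H
  rw [Matrix.conjTranspose_eq_transpose_of_trivial] at this
  exact Matrix.PosDef.posSemidef_add this hR

/-- The Kalman update keeps covariances positive semidefinite: it equals its Joseph form
`(1 - K H) M (1 - K H)ᵀ + K R Kᵀ`. -/
theorem Plant.updCov_posSemidef {M : Matrix (Fin d) (Fin d) ℝ} (hM : M.PosSemidef)
    {Rn : Matrix (Fin p) (Fin p) ℝ} (hR : Rn.PosDef) : (S.updCov M Rn).PosSemidef := by
  have hW := S.innovCov_posDef hM hR
  have hdet := (Matrix.isUnit_iff_isUnit_det _).1 hW.isUnit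
  set K := S.gain M Rn with hK
  have hKW : K * (S.H * M * S.Hᵀ + Rn) = M * S.Hᵀ := by
    rw [hK, Plant.gain, Matrix.nonsing_inv_mul_cancel_right _ _ hdet]
  have h1 := hM.mul_mul_conjTranspose_same (1 - K * S.H)
  have h2 := hR.posSemidef.mul_mul_conjTranspose_same K
  rw [Matrix.conjTranspose_eq_transpose_of_trivial] at h1 h2
  convert h1.add h2 using 1
  have hKR : K * Rn = M * S.Hᵀ - K * (S.H * M * S.Hᵀ) := by
    rw [← hKW, Matrix.mul_add, add_sub_cancel_left]
  rw [hKR, Plant.updCov, ← hK]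
  simp only [Matrix.transpose_sub, Matrix.transpose_mul, Matrix.transpose_one, Matrix.mul_sub,
    Matrix.sub_mul, Matrix.mul_one, Matrix.one_mul, Matrix.mul_assoc]
  abel

/-- A measurement update can only decrease the covariance. -/
theorem Plant.sub_updCov_posSemidef {M : Matrix (Fin d) (Fin d) ℝ} (hM : M.PosSemidef)
    {Rn : Matrix (Fin p) (Fin p) ℝ} (hR : Rn.PosDef) : (M - S.updCov M Rn).PosSemidef := by
  have h := (S.innovCov_posDef hM hR).inv.posSemidef.mul_mul_conjTranspose_same (M * S.Hᵀ)
  rw [Matrix.conjTranspose_eq_transpose_of_trivial, Matrix.transpose_mul,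
    Matrix.transpose_transpose, ← Matrix.conjTranspose_eq_transpose_of_trivial M,
    hM.isHermitian.eq] at h
  have heq : M - S.updCov M Rn = M * S.Hᵀ * (S.H * M * S.Hᵀ + Rn)⁻¹ * (S.H * M) := by
    simp only [Plant.updCov, Plant.gain, Matrix.mul_assoc, sub_sub_cancel]
  rw [heq]
  exact h

theorem Plant.postCov_posSemidef (hP : S.P0.PosSemidef) (hQ : S.Q.PosSemidef)
    (hR : ∀ n, (R (n + 1)).PosDef) (n : ℕ) : (S.postCov R n).PosSemidef := by
  induction n with
  | zero => exact hP
  | succ n ih => exact S.updCov_posSemidef (S.predCov_posSemidef hQ ih) (hR n)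

theorem Plant.aheadCov_zero (j : ℕ) : S.aheadCov R j 0 = S.postCov R j := rfl

theorem Plant.aheadCov_succ (j k : ℕ) :
    S.aheadCov R j (k + 1) = S.predCov (S.aheadCov R j k) :=
  Function.iterate_succ_apply' _ _ _

/-- Whatever is transmitted, the controller never knows more than the sensor. -/
theorem Plant.ctrlCov_sub_postCov_posSemidef (hP : S.P0.PosSemidef) (hQ : S.Q.PosSemidef)
    (hR : ∀ n, (R (n + 1)).PosDef) (a : ℕ → Bool) (n : ℕ) :
    (S.ctrlCov R a n - S.postCov R n).PosSemidef := by
  induction n with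
  | zero => simpa [Plant.ctrlCov, Plant.postCov] using Matrix.PosSemidef.zero
  | succ n ih =>
    by_cases ha : a (n + 1) = true
    · simpa [Plant.ctrlCov, ha] using Matrix.PosSemidef.zero
    · have h1 := S.predCov_sub_posSemidef ih
      have h2 := S.sub_updCov_posSemidef
        (S.predCov_posSemidef hQ (S.postCov_posSemidef R hP hQ hR n)) (hR n)
      simpa [Plant.ctrlCov, Plant.postCov, ha] using h1.add h2

/-- During silence after slot `j`, the controller's covariance dominates the one it would have had
if the sensor had transmitted at `j`. -/
theorem Plant.ctrlCov_sub_aheadCov_posSemidef (hP : S.P0.PosSemidef) (hQ : S.Q.PosSemidef)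
    (hR : ∀ n, (R (n + 1)).PosDef) (a : ℕ → Bool) (j k : ℕ)
    (ha : ∀ i, j < i → i ≤ j + k → a i = false) :
    (S.ctrlCov R a (j + k) - S.aheadCov R j k).PosSemidef := by
  induction k with
  | zero => exact S.ctrlCov_sub_postCov_posSemidef R hP hQ hR a j
  | succ k ih =>
    rw [S.aheadCov_succ, ← add_assoc]
    simp only [Plant.ctrlCov, ha (j + k + 1) (by omega) (by omega)]
    exact S.predCov_sub_posSemidef (ih fun i h1 h2 => ha i h1 (by omega))

/-! ### Transmission epochs and expiration times -/

theorem lastTx_le (a : ℕ → Bool) (n : ℕ) : lastTx a n ≤ n - 1 := by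
  induction n with
  | zero => simp [lastTx]
  | succ n ih => simp only [lastTx]; split_ifs <;> omega

theorem eq_false_of_lastTx_lt (a : ℕ → Bool) {n i : ℕ} (h1 : lastTx a n < i) (h2 : i < n) :
    a i = false := by
  induction n with
  | zero => omega
  | succ n ih =>
    simp only [lastTx] at h1
    split_ifs at h1 with ha
    · omega
    · rcases Nat.lt_succ_iff_lt_or_eq.1 h2 with h | rfl
      · exact ih h1 h
      · simpa using ha

theorem count_eq_count_lastTx_add_one (a : ℕ → Bool) {n : ℕ} (hn : 1 ≤ n) :
    Nat.count (fun i => a i = true) n = Nat.count (fun i => a i = true) (lastTx a n + 1) := by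
  have hle := lastTx_le a n
  obtain ⟨k, hk⟩ := Nat.exists_eq_add_of_le (show lastTx a n + 1 ≤ n by omega)
  conv_lhs => rw [hk]
  rw [Nat.count_add, Nat.add_eq_left, Nat.count_iff_forall_not]
  intro i hi
  simp [eq_false_of_lastTx_lt a (n := n) (i := lastTx a n + 1 + i) (by omega) (by omega)]

theorem lastTx_eq_zero_or (a : ℕ → Bool) (n : ℕ) : lastTx a n = 0 ∨ a (lastTx a n) = true := by
  induction n with
  | zero => simp [lastTx]
  | succ n ih =>
    simp only [lastTx]
    split_ifs with ha
    · exact Or.inr ha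
    · exact ih

/-- The controller's covariance is the open-loop prediction from the latest epoch, the decision of
the current slot included. -/
theorem Plant.ctrlCov_eq_aheadCov (a : ℕ → Bool) (n : ℕ) :
    S.ctrlCov R a n = S.aheadCov R (lastTx a (n + 1)) (n - lastTx a (n + 1)) := by
  induction n with
  | zero => cases h : a 0 <;> simp [lastTx, Plant.ctrlCov, Plant.aheadCov, Plant.postCov]
  | succ n ih =>
    by_cases ha : a (n + 1) = true
    · rw [lastTx, if_pos ha, Nat.sub_self, Plant.aheadCov_zero]
      simp [Plant.ctrlCov, ha]
    · have hle := lastTx_le a (n + 1)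
      rw [lastTx, if_neg ha, Nat.succ_sub (by omega), Plant.aheadCov_succ, ← ih]
      simp [Plant.ctrlCov, ha]

theorem Plant.expiration_le {j k : ℕ} (hk : 1 ≤ k) (h : τ (j + k) < (S.aheadCov R j k).trace) :
    S.expiration R τ j ≤ k :=
  iInf₂_le k ⟨hk, h⟩

theorem Plant.lt_expiration {j k : ℕ}
    (h : ∀ i, 1 ≤ i → i ≤ k → (S.aheadCov R j i).trace ≤ τ (j + i)) :
    (k : ℕ∞) < S.expiration R τ j := by
  rw [← ENat.add_one_le_iff (ENat.natCast_ne_top k)]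
  refine le_iInf₂ fun i hi => ?_
  by_contra hlt
  push Not at hlt
  have : i < k + 1 := by exact_mod_cast hlt
  exact (h i hi.1 (by omega)).not_gt hi.2

theorem Plant.expiration_eq_coe_iff {j k : ℕ} :
    S.expiration R τ j = k ↔ 1 ≤ k ∧ τ (j + k) < (S.aheadCov R j k).trace ∧
      ∀ i, 1 ≤ i → i < k → (S.aheadCov R j i).trace ≤ τ (j + i) := by
  constructor
  · intro h
    have hmin : ∀ i, 1 ≤ i → i < k → (S.aheadCov R j i).trace ≤ τ (j + i) := by
      intro i h1 h2
      by_contra hlt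
      have := S.expiration_le R τ h1 (not_le.1 hlt)
      rw [h] at this
      have : k ≤ i := by exact_mod_cast this
      omega
    have hk : 1 ≤ k := by
      have : ((0 : ℕ) : ℕ∞) < S.expiration R τ j :=
        S.lt_expiration R τ fun i h1 h2 => by omega
      rw [h] at this
      exact_mod_cast this
    refine ⟨hk, ?_, hmin⟩
    by_contra hle
    have : (k : ℕ∞) < S.expiration R τ j := S.lt_expiration R τ fun i h1 h2 => by
      rcases h2.lt_or_eq with h2 | rfl
      · exact hmin i h1 h2
      · exact not_lt.1 hle
    exact (h ▸ this).false
  · rintro ⟨hk, hv, hmin⟩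
    refine le_antisymm (S.expiration_le R τ hk hv) ?_
    have := S.lt_expiration R τ (j := j) (k := k - 1) fun i h1 h2 => hmin i h1 (by omega)
    have h2 := Order.add_one_le_of_lt this
    have h3 : ((k - 1 : ℕ) : ℕ∞) + 1 = k := by exact_mod_cast Nat.sub_add_cancel hk
    rwa [h3] at h2

theorem Plant.validityFrom_eq_one_iff {j n : ℕ} (h : j < n) :
    S.validityFrom R τ j n = 1 ↔ S.expiration R τ j = ((n - j : ℕ) : ℕ∞) := by
  rw [Plant.validityFrom]
  cases S.expiration R τ j with
  | top => simp [-ENat.natCast_sub]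
  | coe t =>
    norm_cast
    omega

/-! ### The just-in-time policy along a path -/

theorem Plant.jit_eq_true_iff {n : ℕ} :
    S.jit R τ n = true ↔ 1 ≤ n ∧
      S.expiration R τ (lastTx (S.jit R τ) n) = ((n - lastTx (S.jit R τ) n : ℕ) : ℕ∞) := by
  rw [jit_iff, Plant.residualValidity]
  refine and_congr_right fun hn => S.validityFrom_eq_one_iff R τ ?_
  have := lastTx_le (S.jit R τ) n
  omega

/-- After the decision of slot `n`, the latest estimate sent by the just-in-time policy has not yet
expired in slot `n`: the transmission that is due when `n` reaches the expiration slot resets the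
age to zero, and every expiration time is positive. -/
theorem Plant.lt_expiration_lastTx_jit (n : ℕ) :
    ((n - lastTx (S.jit R τ) (n + 1) : ℕ) : ℕ∞) <
      S.expiration R τ (lastTx (S.jit R τ) (n + 1)) := by
  have hpos : ∀ j, ((0 : ℕ) : ℕ∞) < S.expiration R τ j := fun j =>
    S.lt_expiration R τ fun i h1 h2 => by omega
  induction n with
  | zero => simpa using hpos _
  | succ n ih =>
    by_cases ha : S.jit R τ (n + 1) = true
    · rw [lastTx, if_pos ha, Nat.sub_self]
      exact hpos _
    · have hle := lastTx_le (S.jit R τ) (n + 1)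
      rw [lastTx, if_neg ha]
      have h1 : ((n + 1 - lastTx (S.jit R τ) (n + 1) : ℕ) : ℕ∞) ≤
          S.expiration R τ (lastTx (S.jit R τ) (n + 1)) := by
        have h2 := Order.add_one_le_of_lt ih
        have h3 : n + 1 - lastTx (S.jit R τ) (n + 1) =
          n - lastTx (S.jit R τ) (n + 1) + 1 := by omega
        rw [h3]
        exact_mod_cast h2
      refine lt_of_le_of_ne h1 fun h => ha ?_
      exact (S.jit_eq_true_iff R τ).2 ⟨by omega, h.symm⟩

/-- If every fresh estimate meets its cap, the just-in-time policy always meets the cap. -/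
theorem Plant.trace_ctrlCov_jit_le (hfeas : ∀ n, (S.postCov R n).trace ≤ τ n) (n : ℕ) :
    (S.ctrlCov R (S.jit R τ) n).trace ≤ τ n := by
  rw [S.ctrlCov_eq_aheadCov]
  have hle := lastTx_le (S.jit R τ) (n + 1)
  have hlt := S.lt_expiration_lastTx_jit R τ n
  generalize lastTx (S.jit R τ) (n + 1) = j at *
  obtain ⟨k, rfl⟩ := Nat.exists_eq_add_of_le (show j ≤ n by omega)
  rw [Nat.add_sub_cancel_left] at *
  rcases Nat.eq_zero_or_pos k with rfl | hk
  · exact hfeas j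
  · by_contra h
    exact (S.expiration_le R τ hk (not_le.1 h)).not_gt hlt

/-- Slot `i` is costly for the decisions `a` if it carries a transmission or a violation of the
cap. -/
def Plant.Costly (a : ℕ → Bool) (i : ℕ) : Prop :=
  a i = true ∨ τ i < (S.ctrlCov R a i).trace

/-- Between two consecutive just-in-time transmissions every decision sequence has a costly
slot. -/
theorem Plant.exists_costly (hP : S.P0.PosSemidef) (hQ : S.Q.PosSemidef)
    (hR : ∀ n, (R (n + 1)).PosDef) (a : ℕ → Bool) {n : ℕ} (hn : S.jit R τ n = true) :
    ∃ i, lastTx (S.jit R τ) n < i ∧ i ≤ n ∧ S.Costly R τ a i := by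
  obtain ⟨h1, hexp⟩ := (S.jit_eq_true_iff R τ).1 hn
  obtain ⟨hk, hviol, -⟩ := (S.expiration_eq_coe_iff R τ).1 hexp
  generalize lastTx (S.jit R τ) n = j at *
  obtain ⟨k, rfl⟩ := Nat.exists_eq_add_of_le (show j ≤ n by omega)
  rw [Nat.add_sub_cancel_left] at *
  by_contra! hno
  have hsilent : ∀ i, j < i → i ≤ j + k → a i = false := fun i hi hi' => by
    by_contra h
    exact hno i hi hi' (Or.inl (by simpa using h))
  have htr := (S.ctrlCov_sub_aheadCov_posSemidef R hP hQ hR a j k hsilent).trace_nonneg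
  rw [Matrix.trace_sub] at htr
  exact hno (j + k) (by omega) le_rfl (Or.inr (by linarith))

open Classical in
/-- Up to any horizon the just-in-time policy transmits at most as often as any other decision
sequence has costly slots. -/
theorem Plant.count_jit_le_count_costly (hP : S.P0.PosSemidef) (hQ : S.Q.PosSemidef)
    (hR : ∀ n, (R (n + 1)).PosDef) (a : ℕ → Bool) (N : ℕ) :
    Nat.count (fun i => S.jit R τ i = true) N ≤ Nat.count (S.Costly R τ a) N := by
  induction N using Nat.strong_induction_on with
  | _ N ih =>
    rcases N with _ | n
    · simp
    by_cases hn : S.jit R τ n = true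
    · obtain ⟨i, hli, hin, hi⟩ := S.exists_costly R τ hP hQ hR a hn
      set l := lastTx (S.jit R τ) n
      calc Nat.count (fun i => S.jit R τ i = true) (n + 1)
          = Nat.count (fun i => S.jit R τ i = true) (l + 1) + 1 := by
            rw [Nat.count_succ, if_pos hn,
              count_eq_count_lastTx_add_one _ (by omega)]
        _ ≤ Nat.count (S.Costly R τ a) i + 1 := by
            gcongr
            exact (ih (l + 1) (by omega)).trans (Nat.count_monotone _ hli)
        _ = Nat.count (S.Costly R τ a) (i + 1) := by rw [Nat.count_succ, if_pos hi]
        _ ≤ Nat.count (S.Costly R τ a) (n + 1) := Nat.count_monotone _ (by omega)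
    · rw [Nat.count_succ, if_neg hn, add_zero]
      exact (ih n (by omega)).trans (Nat.count_monotone _ (by omega))

theorem sum_range_ite_eq_count (q : ℕ → Prop) [DecidablePred q] (N : ℕ) :
    ∑ n ∈ Finset.range N, (if q n then (1 : ℝ) else 0) = Nat.count q N := by
  rw [Finset.sum_boole, Nat.count_eq_card_filter_range]

variable {β c : ℝ}

theorem Plant.sum_reward_jit (hfeas : ∀ n, (S.postCov R n).trace ≤ τ n) (N : ℕ) :
    ∑ n ∈ Finset.range N, S.reward R τ β c (S.jit R τ) n =
      N - β * c * Nat.count (fun i => S.jit R τ i = true) N := by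
  simp only [Plant.reward, S.trace_ctrlCov_jit_le R τ hfeas, if_true]
  rw [Finset.sum_sub_distrib, ← Finset.mul_sum, sum_range_ite_eq_count]
  simp

/-- Along every path and up to every horizon, no decision sequence earns more than the
just-in-time policy. A costly slot loses at least `β c`, since a violation loses `1 ≥ β c`. -/
theorem Plant.sum_reward_le_sum_reward_jit (hP : S.P0.PosSemidef) (hQ : S.Q.PosSemidef)
    (hR : ∀ n, (R (n + 1)).PosDef) (hfeas : ∀ n, (S.postCov R n).trace ≤ τ n)
    (h0 : 0 ≤ β * c) (h1 : β * c ≤ 1) (a : ℕ → Bool) (N : ℕ) :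
    ∑ n ∈ Finset.range N, S.reward R τ β c a n ≤
      ∑ n ∈ Finset.range N, S.reward R τ β c (S.jit R τ) n := by
  classical
  rw [S.sum_reward_jit R τ hfeas]
  calc ∑ n ∈ Finset.range N, S.reward R τ β c a n
      ≤ ∑ n ∈ Finset.range N, (1 - β * c * (if S.Costly R τ a n then 1 else 0)) := by
        refine Finset.sum_le_sum fun n _ => ?_
        by_cases ha : a n = true
        · simp only [Plant.reward, Plant.Costly, ha, true_or, if_true]
          split_ifs <;> linarith
        · simp only [Plant.reward, Plant.Costly, ha]
          by_cases hv : τ n < (S.ctrlCov R a n).trace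
          · simp [hv, not_le.2 hv, h1]
          · simp [hv, not_lt.1 hv]
    _ = N - β * c * Nat.count (S.Costly R τ a) N := by
        rw [Finset.sum_sub_distrib, ← Finset.mul_sum, sum_range_ite_eq_count]
        simp
    _ ≤ N - β * c * Nat.count (fun i => S.jit R τ i = true) N := by
        have := S.count_jit_le_count_costly R τ hP hQ hR a N
        have : (Nat.count (fun i => S.jit R τ i = true) N : ℝ) ≤ Nat.count (S.Costly R τ a) N := by
          exact_mod_cast this
        exact sub_le_sub_left (mul_le_mul_of_nonneg_left this h0) _

theorem Plant.abs_reward_le (h0 : 0 ≤ β * c) (h1 : β * c ≤ 1) (a : ℕ → Bool) (n : ℕ) :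
    |S.reward R τ β c a n| ≤ 1 := by
  rw [abs_le, Plant.reward]
  constructor <;> split_ifs <;> linarith

end Pathwise

section Renewal

variable {d m p : ℕ} (S : Plant d m p)
variable (R : ℕ → Matrix (Fin p) (Fin p) ℝ) (τ : ℕ → ℝ)

/-! ### Renewal structure of the just-in-time transmissions -/

theorem Plant.jitExpiration_count {n : ℕ} (hn : S.jit R τ n = true) :
    S.jitExpiration R τ (Nat.count (fun i => S.jit R τ i = true) n) = S.expiration R τ n := by
  refine le_antisymm (iInf₂_le n ⟨hn, rfl⟩) (le_iInf₂ fun n' hn' => ?_)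
  rw [Nat.count_injective hn hn'.1 hn'.2.symm]

/-- Each just-in-time transmission happens exactly when its predecessor expires, so its slot is the
sum of all expiration times before it, that of the initial estimate included. -/
theorem Plant.slot_eq_sum_jitExpiration {n : ℕ} (hn : S.jit R τ n = true) :
    (n : ℝ≥0∞) = (S.expiration R τ 0 : ℝ≥0∞) +
      ∑ k ∈ Finset.range (Nat.count (fun i => S.jit R τ i = true) n),
        (S.jitExpiration R τ k : ℝ≥0∞) := by
  induction n using Nat.strong_induction_on with
  | _ n ih =>
    obtain ⟨h1, hexp⟩ := (S.jit_eq_true_iff R τ).1 hn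
    have hle := lastTx_le (S.jit R τ) n
    have h0 := lastTx_eq_zero_or (S.jit R τ) n
    have hcount := count_eq_count_lastTx_add_one (S.jit R τ) h1
    generalize lastTx (S.jit R τ) n = l at *
    rw [hcount, Nat.count_succ]
    cases hl : S.jit R τ l with
    | true =>
      rw [if_pos rfl, Finset.sum_range_succ, ← add_assoc, ← ih l (by omega) hl,
        S.jitExpiration_count R τ hl, hexp, ENat.toENNReal_coe]
      norm_cast
      omega
    | false =>
      obtain rfl : l = 0 := h0.resolve_right (by simp [hl])
      simp [hexp]

/-- The rate of just-in-time transmissions is the inverse of the mean expiration time. -/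
theorem Plant.tendsto_count_jit_div {Tbar : ℝ≥0∞} (hT : Tbar ≠ 0)
    (h : Tendsto (fun K : ℕ => (∑ k ∈ Finset.range K, (S.jitExpiration R τ k : ℝ≥0∞)) / (K : ℝ≥0∞))
      atTop (𝓝 Tbar)) :
    Tendsto (fun N : ℕ => (Nat.count (fun i => S.jit R τ i = true) N : ℝ) / N) atTop
      (𝓝 (Tbar⁻¹).toReal) := by
  set q : ℕ → Prop := fun i => S.jit R τ i = true with hq
  by_cases hinf : (Set.ofPred q).Infinite
  · set e : ℕ → ℕ := Nat.nth q with he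
    have he_strict : StrictMono e := Nat.nth_strictMono hinf
    have hslot : ∀ k, (e k : ℝ≥0∞) = (S.expiration R τ 0 : ℝ≥0∞) +
        ∑ i ∈ Finset.range k, (S.jitExpiration R τ i : ℝ≥0∞) := fun k => by
      have := S.slot_eq_sum_jitExpiration R τ (Nat.nth_mem_of_infinite hinf k)
      rwa [Nat.count_nth_of_infinite hinf k] at this
    have hT0 : (S.expiration R τ 0 : ℝ≥0∞) ≠ ⊤ := by
      have := hslot 0
      rw [Finset.range_zero, Finset.sum_empty, add_zero] at this
      rw [← this]
      exact ENNReal.natCast_ne_top _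
    have hmean : Tendsto (fun k : ℕ => (e k : ℝ≥0∞) / k) atTop (𝓝 Tbar) := by
      have h1 : Tendsto (fun k : ℕ => (S.expiration R τ 0 : ℝ≥0∞) / k) atTop (𝓝 0) := by
        simpa [div_eq_mul_inv] using
          ENNReal.Tendsto.const_mul ENNReal.tendsto_inv_nat_nhds_zero (Or.inr hT0)
      simpa [hslot, ENNReal.add_div] using h1.add h
    have hrate : Tendsto (fun k : ℕ => (k : ℝ) / e k) atTop (𝓝 (Tbar⁻¹).toReal) := by
      have h1 := (ENNReal.tendsto_toReal (ENNReal.inv_ne_top.2 hT)).comp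
        ((continuous_inv.tendsto Tbar).comp hmean)
      refine h1.congr fun k => ?_
      simp [ENNReal.toReal_inv, ENNReal.toReal_div]
    have hcount : Tendsto (Nat.count q) atTop atTop := by
      refine tendsto_atTop_atTop.2 fun k => ⟨e k, fun N hN => ?_⟩
      rw [← Nat.count_nth_of_infinite hinf k]
      exact Nat.count_monotone _ hN
    -- Squeeze: `e (C - 1) < N ≤ e C` for the number `C` of transmissions before slot `N`.
    have hpred : Tendsto (fun N => Nat.count q N - 1) atTop atTop :=
      (tendsto_sub_atTop_nat 1).comp hcount
    have hsmall : Tendsto (fun k : ℕ => (1 : ℝ) / e k) atTop (𝓝 0) :=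
      tendsto_one_div_atTop_nhds_zero_nat.comp he_strict.tendsto_atTop
    have hupper := (hrate.add hsmall).comp hpred
    rw [add_zero] at hupper
    refine tendsto_of_tendsto_of_tendsto_of_le_of_le' (hrate.comp hcount) hupper ?_ ?_
    · filter_upwards [eventually_gt_atTop 0] with N hN
      have hle : N ≤ e (Nat.count q N) := Nat.le_nth_count hinf N
      have : (0 : ℝ) < N := by exact_mod_cast hN
      simp only [Function.comp]
      gcongr
    · filter_upwards [hpred.eventually_gt_atTop 0] with N hN
      have hlt : e (Nat.count q N - 1) < N := Nat.nth_lt_of_lt_count (by omega)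
      have hpos : 0 < e (Nat.count q N - 1) := (Nat.zero_le _).trans_lt (he_strict hN)
      have hpos' : (0 : ℝ) < e (Nat.count q N - 1) := by exact_mod_cast hpos
      simp only [Function.comp]
      rw [← add_div]
      have hcast : ((Nat.count q N - 1 : ℕ) : ℝ) + 1 = Nat.count q N := by
        exact_mod_cast Nat.sub_add_cancel (by omega)
      rw [hcast]
      gcongr
  · -- With finitely many transmissions the last estimate never expires, which forces `Tbar = ⊤`.
    have hfin : (Set.ofPred q).Finite := Set.not_infinite.1 hinf
    set K₀ := hfin.toFinset.card with hK₀
    have hbound : ∀ N, Nat.count q N ≤ K₀ := fun N => by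
      rw [Nat.count_eq_card_filter_range]
      exact Finset.card_le_card fun i hi => by simpa using (Finset.mem_filter.1 hi).2
    have htop : S.jitExpiration R τ K₀ = ⊤ := by
      refine iInf₂_eq_top.2 fun n hn => absurd (hbound (n + 1)) ?_
      rw [Nat.count_succ, if_pos hn.1, hn.2]
      omega
    have hTtop : Tbar = ⊤ := by
      refine tendsto_nhds_unique h (tendsto_const_nhds.congr' ?_)
      filter_upwards [eventually_gt_atTop K₀] with K hK
      have hsum : ∑ k ∈ Finset.range K, (S.jitExpiration R τ k : ℝ≥0∞) = ⊤ :=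
        ENNReal.sum_eq_top.2 ⟨K₀, Finset.mem_range.2 hK, by simp [htop]⟩
      rw [hsum, ENNReal.top_div_of_ne_top (ENNReal.natCast_ne_top K)]
    rw [hTtop, ENNReal.inv_top, ENNReal.toReal_zero]
    refine squeeze_zero (fun N => by positivity) (fun N => ?_)
      (tendsto_const_div_atTop_nhds_zero_nat (K₀ : ℝ))
    have := hbound N
    gcongr

end Renewal

/-! ### Measurability of the filter and of the closed loop -/

section MatrixMeasurability

variable {Ω : Type*} [MeasurableSpace Ω] {l m n : ℕ}

instance instBorelSpaceMatrix (m n : ℕ) : BorelSpace (Matrix (Fin m) (Fin n) ℝ) :=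
  inferInstanceAs (BorelSpace (Fin m → Fin n → ℝ))

theorem measurable_matrix_iff {f : Ω → Matrix (Fin m) (Fin n) ℝ} :
    Measurable f ↔ ∀ i j, Measurable fun ω => f ω i j :=
  measurable_pi_iff.trans (forall_congr' fun _ => measurable_pi_iff)

theorem measurable_matrix_add {f g : Ω → Matrix (Fin m) (Fin n) ℝ} (hf : Measurable f)
    (hg : Measurable g) : Measurable fun ω => f ω + g ω :=
  measurable_matrix_iff.2 fun i j =>
    (measurable_matrix_iff.1 hf i j).add (measurable_matrix_iff.1 hg i j)

theorem measurable_matrix_sub {f g : Ω → Matrix (Fin m) (Fin n) ℝ} (hf : Measurable f)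
    (hg : Measurable g) : Measurable fun ω => f ω - g ω :=
  measurable_matrix_iff.2 fun i j =>
    (measurable_matrix_iff.1 hf i j).sub (measurable_matrix_iff.1 hg i j)

theorem measurable_matrix_mul {f : Ω → Matrix (Fin l) (Fin m) ℝ}
    {g : Ω → Matrix (Fin m) (Fin n) ℝ} (hf : Measurable f) (hg : Measurable g) :
    Measurable fun ω => f ω * g ω :=
  measurable_matrix_iff.2 fun i j => by
    simp only [Matrix.mul_apply]
    exact Finset.measurable_sum _ fun k _ =>
      (measurable_matrix_iff.1 hf i k).mul (measurable_matrix_iff.1 hg k j)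

theorem measurable_matrix_mulVec {f : Ω → Matrix (Fin m) (Fin n) ℝ} {g : Ω → Fin n → ℝ}
    (hf : Measurable f) (hg : Measurable g) : Measurable fun ω => f ω *ᵥ g ω :=
  measurable_pi_iff.2 fun i => by
    simp only [Matrix.mulVec, dotProduct]
    exact Finset.measurable_sum _ fun k _ =>
      (measurable_matrix_iff.1 hf i k).mul (measurable_pi_iff.1 hg k)

theorem measurable_matrix_inv {f : Ω → Matrix (Fin n) (Fin n) ℝ} (hf : Measurable f) :
    Measurable fun ω => (f ω)⁻¹ :=
  measurable_matrix_iff.2 fun i j => by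
    have hdet : Measurable fun ω => (f ω).det :=
      (continuous_id.matrix_det).measurable.comp hf
    have hadj : Measurable fun ω => (f ω).adjugate :=
      (continuous_id.matrix_adjugate).measurable.comp hf
    simp only [Matrix.inv_def, Matrix.smul_apply, Ring.inverse_eq_inv', smul_eq_mul]
    exact hdet.inv.mul (measurable_matrix_iff.1 hadj i j)

theorem measurable_matrix_trace {f : Ω → Matrix (Fin n) (Fin n) ℝ} (hf : Measurable f) :
    Measurable fun ω => (f ω).trace :=
  Finset.measurable_sum _ fun i _ => measurable_matrix_iff.1 hf i i

end MatrixMeasurability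

section Measurability

variable {d m p : ℕ} {Ω : Type*} [MeasurableSpace Ω] (S : Plant d m p)
variable {R : ℕ → Ω → Matrix (Fin p) (Fin p) ℝ} {τ : ℕ → Ω → ℝ}

theorem Plant.measurable_predCov {f : Ω → Matrix (Fin d) (Fin d) ℝ} (hf : Measurable f) :
    Measurable fun ω => S.predCov (f ω) :=
  measurable_matrix_add (measurable_matrix_mul (measurable_matrix_mul measurable_const hf)
    measurable_const) measurable_const

theorem Plant.measurable_gain {f : Ω → Matrix (Fin d) (Fin d) ℝ}
    {g : Ω → Matrix (Fin p) (Fin p) ℝ} (hf : Measurable f) (hg : Measurable g) :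
    Measurable fun ω => S.gain (f ω) (g ω) :=
  measurable_matrix_mul (measurable_matrix_mul hf measurable_const) (measurable_matrix_inv
    (measurable_matrix_add (measurable_matrix_mul (measurable_matrix_mul measurable_const hf)
      measurable_const) hg))

theorem Plant.measurable_updCov {f : Ω → Matrix (Fin d) (Fin d) ℝ}
    {g : Ω → Matrix (Fin p) (Fin p) ℝ} (hf : Measurable f) (hg : Measurable g) :
    Measurable fun ω => S.updCov (f ω) (g ω) :=
  measurable_matrix_sub hf (measurable_matrix_mul (measurable_matrix_mul
    (S.measurable_gain hf hg) measurable_const) hf)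

theorem Plant.measurable_postCov {n : ℕ} (hR : ∀ k < n, Measurable (R (k + 1))) :
    Measurable fun ω => S.postCov (fun k => R k ω) n := by
  induction n with
  | zero => exact measurable_const
  | succ n ih =>
    exact S.measurable_updCov
      (S.measurable_predCov (ih fun k hk => hR k (hk.trans n.lt_succ_self))) (hR n n.lt_succ_self)

theorem Plant.measurable_aheadCov {j : ℕ} (hR : ∀ k < j, Measurable (R (k + 1))) (k : ℕ) :
    Measurable fun ω => S.aheadCov (fun i => R i ω) j k := by
  induction k with
  | zero => exact S.measurable_postCov hR
  | succ k ih =>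
    simp only [Plant.aheadCov_succ]
    exact S.measurable_predCov ih

theorem Plant.measurableSet_expiration_eq {j : ℕ} (hR : ∀ k < j, Measurable (R (k + 1)))
    (hτ : ∀ k, Measurable (τ k)) (k : ℕ) :
    MeasurableSet {ω | S.expiration (fun i => R i ω) (fun i => τ i ω) j = k} := by
  simp only [Plant.expiration_eq_coe_iff]
  have htr := fun i => measurable_matrix_trace (S.measurable_aheadCov hR i)
  have hmin : MeasurableSet {ω | ∀ i, 1 ≤ i → i < k →
      (S.aheadCov (fun i => R i ω) j i).trace ≤ τ (j + i) ω} := by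
    simp only [Set.ofPred_forall]
    exact MeasurableSet.iInter fun i => MeasurableSet.iInter fun _ => MeasurableSet.iInter fun _ =>
      measurableSet_le (htr _) (hτ _)
  exact (MeasurableSet.const _).inter ((measurableSet_lt (hτ _) (htr _)).inter hmin)

/-- The decision of the just-in-time policy at slot `n` is measurable already with respect to the
tolerances and `R 1, …, R n`; it uses no measurement. -/
theorem Plant.measurable_jit {n : ℕ} (hR : ∀ k < n, Measurable (R (k + 1)))
    (hτ : ∀ k, Measurable (τ k)) :
    Measurable fun ω => S.jit (fun i => R i ω) (fun i => τ i ω) n := by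
  have step : ∀ n, (∀ k < n, Measurable (R (k + 1))) →
      (Measurable fun ω => lastTx (S.jit (fun i => R i ω) (fun i => τ i ω)) n) →
      Measurable fun ω => S.jit (fun i => R i ω) (fun i => τ i ω) n := by
    intro n hR hlast
    refine measurable_to_bool ?_
    have heq : (fun ω => S.jit (fun i => R i ω) (fun i => τ i ω) n) ⁻¹' {true} =
        {ω | 1 ≤ n} ∩ ⋃ j ∈ Set.Iio n,
          ({ω | lastTx (S.jit (fun i => R i ω) (fun i => τ i ω)) n = j} ∩
          {ω | S.expiration (fun i => R i ω) (fun i => τ i ω) j = ((n - j : ℕ) : ℕ∞)}) := by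
      ext ω
      have hle := lastTx_le (S.jit (fun i => R i ω) (fun i => τ i ω)) n
      simp only [Set.mem_preimage, Set.mem_singleton_iff, Plant.jit_eq_true_iff, Set.mem_inter_iff,
        Set.mem_ofPred_eq, Set.mem_iUnion, Set.mem_Iio, exists_prop]
      refine and_congr_right fun hn => ⟨fun h => ⟨_, by omega, rfl, h⟩, ?_⟩
      rintro ⟨j, -, rfl, h⟩
      exact h
    rw [heq]
    exact (MeasurableSet.const _).inter (MeasurableSet.biUnion (Set.to_countable _) fun j hj =>
      (hlast (measurableSet_singleton j)).inter
        (S.measurableSet_expiration_eq (fun k hk => hR k (hk.trans hj)) hτ _))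
  have hlast : ∀ n, (∀ k < n, Measurable (R (k + 1))) →
      Measurable fun ω => lastTx (S.jit (fun i => R i ω) (fun i => τ i ω)) n := by
    intro n
    induction n with
    | zero => exact fun _ => measurable_const
    | succ n ih =>
      intro hR
      have hR' : ∀ k < n, Measurable (R (k + 1)) := fun k hk => hR k (hk.trans n.lt_succ_self)
      exact Measurable.ite (step n hR' (ih hR') (measurableSet_singleton true)) measurable_const
        (ih hR')
  exact step n hR (hlast n hR)

variable {a : ℕ → Ω → Bool}

theorem Plant.measurable_ctrlCov (hR : ∀ k, Measurable (R k)) {n : ℕ}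
    (ha : ∀ k ≤ n, Measurable (a k)) :
    Measurable fun ω => S.ctrlCov (fun i => R i ω) (fun i => a i ω) n := by
  induction n with
  | zero => exact measurable_const
  | succ n ih =>
    exact Measurable.ite (ha (n + 1) le_rfl (measurableSet_singleton true))
      (S.measurable_postCov fun k _ => hR _)
      (S.measurable_predCov (ih fun k hk => ha k (hk.trans n.le_succ)))

variable {x0 : Ω → Fin d → ℝ} {w : ℕ → Ω → Fin d → ℝ} {v : ℕ → Ω → Fin p → ℝ}

/-- The plant state of slot `n` involves only the decisions before slot `n`, whereas the
estimates may also involve the decision of slot `n`. -/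
theorem Plant.measurable_loop (hctrl : Measurable (Function.uncurry S.controller))
    (hx0 : Measurable x0) (hw : ∀ n, Measurable (w n)) (hv : ∀ n, Measurable (v n))
    (hR : ∀ k, Measurable (R k)) (n : ℕ) (ha : ∀ k < n, Measurable (a k)) :
    (Measurable fun ω => (S.loop (fun i => R i ω) (x0 ω) (fun i => w i ω) (fun i => v i ω)
      (fun i => a i ω) n).1) ∧
    (Measurable (a n) → Measurable fun ω => S.loop (fun i => R i ω) (x0 ω) (fun i => w i ω)
      (fun i => v i ω) (fun i => a i ω) n) := by
  induction n with
  | zero => exact ⟨hx0, fun _ => hx0.prodMk (measurable_const.prodMk measurable_const)⟩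
  | succ n ih =>
    have hs := (ih fun k hk => ha k (hk.trans n.lt_succ_self)).2 (ha n n.lt_succ_self)
    have hu : Measurable fun ω => S.controller
        (S.loop (fun i => R i ω) (x0 ω) (fun i => w i ω) (fun i => v i ω) (fun i => a i ω) n).2.2
        (S.ctrlCov (fun i => R i ω) (fun i => a i ω) n) :=
      hctrl.comp (hs.snd.snd.prodMk
        (S.measurable_ctrlCov hR fun k hk => ha k (Nat.lt_succ_of_le hk)))
    have hBu := measurable_matrix_mulVec (measurable_const (a := S.B)) hu
    have hx := ((measurable_matrix_mulVec (measurable_const (a := S.A)) hs.fst).add hBu).add (hw n)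
    have hxpred := (measurable_matrix_mulVec (measurable_const (a := S.A)) hs.snd.fst).add hBu
    have hy := (measurable_matrix_mulVec (measurable_const (a := S.H)) hx).add (hv (n + 1))
    have hgain := S.measurable_gain
      (S.measurable_predCov (S.measurable_postCov (n := n) fun k _ => hR (k + 1))) (hR (n + 1))
    have hxhat := hxpred.add (measurable_matrix_mulVec hgain
      (hy.sub (measurable_matrix_mulVec (measurable_const (a := S.H)) hxpred)))
    refine ⟨hx, fun hlast => hx.prodMk (hxhat.prodMk ?_)⟩
    exact Measurable.ite (hlast (measurableSet_singleton true)) hxhat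
      ((measurable_matrix_mulVec (measurable_const (a := S.A)) hs.snd.snd).add hBu)

/-- The decisions of a causal policy are random variables: the measurements that slot `n` may use
are measurable as soon as the earlier decisions are. -/
theorem Plant.Causal.measurable {S : Plant d m p}
    (hctrl : Measurable (Function.uncurry S.controller))
    (hx0 : Measurable x0) (hw : ∀ n, Measurable (w n)) (hv : ∀ n, Measurable (v n))
    (hR : ∀ k, Measurable (R k)) (hτ : ∀ k, Measurable (τ k))
    (hcausal : S.Causal x0 w v R τ a) (n : ℕ) : Measurable (a n) := by
  induction n using Nat.strong_induction_on with
  | _ n ih =>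
    refine (hcausal n).mono (Measurable.comap_le ?_) le_rfl
    refine (measurable_pi_iff.2 hτ).prodMk ((measurable_pi_iff.2 fun k => hR _).prodMk
      (measurable_pi_iff.2 fun k => ?_))
    exact (measurable_matrix_mulVec (measurable_const (a := S.H))
      (S.measurable_loop hctrl hx0 hw hv hR (k + 1) fun i hi => ih i (by omega)).1).add (hv (k + 1))

theorem Plant.measurable_reward (β c : ℝ) (hR : ∀ k, Measurable (R k))
    (hτ : ∀ k, Measurable (τ k)) (ha : ∀ k, Measurable (a k)) (n : ℕ) :
    Measurable fun ω => S.reward (fun k => R k ω) (fun k => τ k ω) β c (fun k => a k ω) n := by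
  have htr := measurable_matrix_trace (S.measurable_ctrlCov hR (n := n) fun k _ => ha k)
  exact (Measurable.ite (measurableSet_le htr (hτ n)) measurable_const measurable_const).sub
    (measurable_const.mul
      (Measurable.ite (ha n (measurableSet_singleton true)) measurable_const measurable_const))

end Measurability

theorem Plant.causal_jitPolicy {d m p : ℕ} {Ω : Type*} (S : Plant d m p)
    (x0 : Ω → Fin d → ℝ) (w : ℕ → Ω → Fin d → ℝ) (v : ℕ → Ω → Fin p → ℝ)
    (R : ℕ → Ω → Matrix (Fin p) (Fin p) ℝ) (τ : ℕ → Ω → ℝ) :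
    S.Causal x0 w v R τ (S.jitPolicy R τ) := by
  intro n
  let _ : MeasurableSpace Ω := S.info x0 w v R τ (S.jitPolicy R τ) n
  have hinfo := comap_measurable (m := inferInstance) (fun ω =>
    ((fun k : ℕ => τ k ω), (fun k : Fin n => R (k + 1) ω),
      (fun k : Fin n => S.meas (fun i => R i ω) (x0 ω) (fun i => w i ω) (fun i => v i ω)
        (fun i => S.jitPolicy R τ i ω) (k + 1))))
  exact S.measurable_jit (fun k hk => measurable_pi_iff.1 hinfo.snd.fst ⟨k, hk⟩)
    (fun k => measurable_pi_iff.1 hinfo.fst k)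

/-! ### Long-run averages -/

section LongRun

variable {d m p : ℕ} {Ω : Type*} [MeasurableSpace Ω] (S : Plant d m p) (μ : Measure Ω)
  [IsProbabilityMeasure μ]
variable {R : ℕ → Ω → Matrix (Fin p) (Fin p) ℝ} {τ : ℕ → Ω → ℝ} {a : ℕ → Ω → Bool} {β c : ℝ}

theorem Plant.abs_sum_reward_le (h0 : 0 ≤ β * c) (h1 : β * c ≤ 1)
    (R : ℕ → Matrix (Fin p) (Fin p) ℝ) (τ : ℕ → ℝ) (a : ℕ → Bool) (N : ℕ) :
    |∑ n ∈ Finset.range N, S.reward R τ β c a n| ≤ N :=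
  (Finset.abs_sum_le_sum_abs _ _).trans <|
    (Finset.sum_le_card_nsmul _ _ 1 fun n _ => S.abs_reward_le R τ h0 h1 a n).trans (by simp)

theorem Plant.integrable_sum_reward (h0 : 0 ≤ β * c) (h1 : β * c ≤ 1)
    (hR : ∀ k, Measurable (R k)) (hτ : ∀ k, Measurable (τ k)) (ha : ∀ k, Measurable (a k))
    (N : ℕ) :
    Integrable (fun ω => ∑ n ∈ Finset.range N,
      S.reward (fun k => R k ω) (fun k => τ k ω) β c (fun k => a k ω) n) μ :=
  Integrable.of_bound
    (Finset.measurable_sum _ fun n _ => S.measurable_reward β c hR hτ ha n).aestronglyMeasurable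
    (N : ℝ) (ae_of_all _ fun _ => S.abs_sum_reward_le h0 h1 _ _ _ N)

theorem Plant.abs_mean_reward_le (h0 : 0 ≤ β * c) (h1 : β * c ≤ 1)
    (R : ℕ → Ω → Matrix (Fin p) (Fin p) ℝ) (τ : ℕ → Ω → ℝ) (a : ℕ → Ω → Bool) (N : ℕ) :
    |(1 / (N : ℝ)) * ∫ ω, ∑ n ∈ Finset.range N,
      S.reward (fun k => R k ω) (fun k => τ k ω) β c (fun k => a k ω) n ∂μ| ≤ 1 := by
  have h : ‖∫ ω, ∑ n ∈ Finset.range N,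
      S.reward (fun k => R k ω) (fun k => τ k ω) β c (fun k => a k ω) n ∂μ‖ ≤ N := by
    refine (norm_integral_le_of_norm_le_const (C := (N : ℝ)) (ae_of_all _ fun ω => ?_)).trans
      (by simp)
    exact S.abs_sum_reward_le h0 h1 _ _ _ N
  rw [abs_mul, abs_of_nonneg (by positivity : (0 : ℝ) ≤ 1 / N), one_div, ← div_eq_inv_mul]
  exact div_le_one_of_le₀ h N.cast_nonneg

/-- A policy whose reward sums are almost surely dominated, horizon by horizon, has the smaller
long-run value. -/
theorem Plant.value_mono {b : ℕ → Ω → Bool} (h0 : 0 ≤ β * c) (h1 : β * c ≤ 1)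
    (hR : ∀ k, Measurable (R k)) (hτ : ∀ k, Measurable (τ k)) (ha : ∀ k, Measurable (a k))
    (hb : ∀ k, Measurable (b k))
    (hle : ∀ᵐ ω ∂μ, ∀ N, ∑ n ∈ Finset.range N,
        S.reward (fun k => R k ω) (fun k => τ k ω) β c (fun k => a k ω) n ≤
      ∑ n ∈ Finset.range N,
        S.reward (fun k => R k ω) (fun k => τ k ω) β c (fun k => b k ω) n) :
    S.value μ R τ β c a ≤ S.value μ R τ β c b := by
  refine liminf_le_liminf (Eventually.of_forall fun N => ?_) ?_ ?_
  · refine mul_le_mul_of_nonneg_left (integral_mono_ae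
      (S.integrable_sum_reward μ h0 h1 hR hτ ha N)
      (S.integrable_sum_reward μ h0 h1 hR hτ hb N) ?_) (by positivity)
    filter_upwards [hle] with ω hω using hω N
  · exact isBoundedUnder_of ⟨-1, fun N => (abs_le.1 (S.abs_mean_reward_le μ h0 h1 R τ a N)).1⟩
  · exact (isBoundedUnder_of
      ⟨1, fun N => (abs_le.1 (S.abs_mean_reward_le μ h0 h1 R τ b N)).2⟩).isCoboundedUnder_ge

/-- If the time average of the rewards converges almost surely to a constant, that constant is the
long-run expected reward, by dominated convergence. -/
theorem Plant.value_eq_of_tendsto (h0 : 0 ≤ β * c) (h1 : β * c ≤ 1)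
    (hR : ∀ k, Measurable (R k)) (hτ : ∀ k, Measurable (τ k)) (ha : ∀ k, Measurable (a k)) {r : ℝ}
    (h : ∀ᵐ ω ∂μ, Tendsto (fun N : ℕ => (1 / (N : ℝ)) * ∑ n ∈ Finset.range N,
      S.reward (fun k => R k ω) (fun k => τ k ω) β c (fun k => a k ω) n) atTop (𝓝 r)) :
    S.value μ R τ β c a = r := by
  have hlim := tendsto_integral_of_dominated_convergence (μ := μ) (fun _ => (1 : ℝ))
    (fun N => ((S.integrable_sum_reward μ h0 h1 hR hτ ha N).const_mul
      (1 / (N : ℝ))).aestronglyMeasurable)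
    (integrable_const _) (fun N => ae_of_all _ fun ω => by
      rw [Real.norm_eq_abs, abs_mul, abs_of_nonneg (by positivity : (0 : ℝ) ≤ 1 / N), one_div,
        ← div_eq_inv_mul]
      exact div_le_one_of_le₀ (S.abs_sum_reward_le h0 h1 _ _ _ N) N.cast_nonneg) h
  simp only [integral_const_mul, integral_const, probReal_univ, one_smul] at hlim
  exact hlim.liminf_eq

end LongRun

end JIT

theorem theorem1 {d m p : ℕ} {Ω : Type*} [MeasurableSpace Ω] (μ : Measure Ω)
    [IsProbabilityMeasure μ]
    (S : JIT.Plant d m p)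
    (x0 : Ω → Fin d → ℝ) (w : ℕ → Ω → Fin d → ℝ) (v : ℕ → Ω → Fin p → ℝ)
    (R : ℕ → Ω → Matrix (Fin p) (Fin p) ℝ) (τ : ℕ → Ω → ℝ)
    (hplant : S.IsLinearGaussian μ x0 w v R)
    (hτ : JIT.IsToleranceProcess μ R τ)
    (hfeas : ∀ n, ∀ᵐ ω ∂μ, (S.postCov (fun k => R k ω) n).trace ≤ τ n ω)
    (β c : ℝ) (hβ : 0 < β) (hc : 0 ≤ c)
    (Tbar : ℝ≥0∞)
    (hTbar : ∀ᵐ ω ∂μ, Tendsto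
      (fun K : ℕ => (∑ k ∈ Finset.range K,
        ((S.jitExpiration (fun i => R i ω) (fun i => τ i ω) k : ℕ∞) : ℝ≥0∞)) / (K : ℝ≥0∞))
      atTop (𝓝 Tbar))
    (hβc : β * c ≤ 1) (hβcT : ENNReal.ofReal (β * c) < Tbar) :
    S.Causal x0 w v R τ (S.jitPolicy R τ) ∧
    (∀ a : ℕ → Ω → Bool, S.Causal x0 w v R τ a →
      S.value μ R τ β c a ≤ S.value μ R τ β c (S.jitPolicy R τ)) ∧
    S.value μ R τ β c (S.jitPolicy R τ) = 1 - (ENNReal.ofReal (β * c) / Tbar).toReal := by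
  have h0 : 0 ≤ β * c := by positivity
  have hcausal := S.causal_jitPolicy x0 w v R τ
  have hmeas : ∀ {a}, S.Causal x0 w v R τ a → ∀ n, Measurable (a n) := fun ha =>
    ha.measurable hplant.measurable_controller hplant.measurable_x0 hplant.measurable_w
      hplant.measurable_v hplant.measurable_R hτ.measurable
  have hRpos := ae_all_iff.2 hplant.R_posDef
  have hfeas' := ae_all_iff.2 hfeas
  refine ⟨hcausal, fun a ha => ?_, ?_⟩
  · refine S.value_mono μ h0 hβc hplant.measurable_R hτ.measurable (hmeas ha) (hmeas hcausal) ?_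
    filter_upwards [hRpos, hfeas'] with ω hRω hfω N
    exact S.sum_reward_le_sum_reward_jit _ _ hplant.P0_posSemidef hplant.Q_posDef.posSemidef hRω
      hfω h0 hβc _ N
  · refine S.value_eq_of_tendsto μ h0 hβc hplant.measurable_R hτ.measurable (hmeas hcausal) ?_
    filter_upwards [hfeas', hTbar] with ω hfω hTω
    have hrate := S.tendsto_count_jit_div _ _ hβcT.ne_bot hTω
    rw [div_eq_mul_inv, ENNReal.toReal_mul, ENNReal.toReal_ofReal h0]
    refine ((hrate.const_mul (β * c)).const_sub 1).congr' ?_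
    filter_upwards [eventually_gt_atTop 0] with N hN
    have hN' : (N : ℝ) ≠ 0 := by positivity
    simp only [JIT.Plant.jitPolicy]
    rw [S.sum_reward_jit _ _ hfω]
    field_simp
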